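/- Let $d\ge 1$ be an integer, let $\|\cdot\|$ be the Euclidean norm and $\lambda_d$ Lebesgue measure on $\mathbb{R}^d$. For $m\ge 0$ divide $[0,1]$ into the $2^{dm}$ closed intervals $I^m(k)=[k2^{-dm},(k+1)2^{-dm}]$, $0\le k<2^{dm}$, and $[0,1]^d$ into the $2^{dm}$ closed dyadic subcubes of side $2^{-m}$. Let $H_m$ ($m\ge 0$) be mappings from the intervals $I^m(k)$ to the dyadic subcubes of side $2^{-m}$ such that: $H_m(I^m(k))\ne H_m(I^m(k'))$ for $k\ne k'$; $H_m(I^m(k))$ and $H_m(I^m(k+1))$ have a $(d-1)$-dimensional face in common; and $H_m(I^m(k))=\bigcup_{\ell=0}^{2^d-1}H_{m+1}(I^{m+1}(2^dk+\ell))$. Let $H:[0,1]\to[0,1]^d$ be the Hilbert curve that they generate: $H(x)$ is the point to which the cubes $H_m(I^m(k_m))$ shrink as $m\to\infty$, where $x\in I^m(k_m)$ for all $m$. For $n\ge 1$ let $\Delta_1,\dots,\Delta_n$ be independent and uniformly distributed on $[0,1]$, let $x_i=(i-1+\Delta_i)/n$, and for $f:[0,1]^d\to\mathbb{R}$ let $$\hat\mu_n=\frac1n\sum_{i=1}^n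 f(H(x_i)).$$ 1. If $f\in L^2([0,1]^d)$, then $\hat\mu_n$ is square integrable and unbiased: $\mathbb{E}\,\hat\mu_n=\int_{[0,1]^d}f(x)\,dx$ for every $n\ge1$. 2. If $f$ is Lipschitz continuous on $[0,1]^d$, i.e. $|f(x)-f(y)|\le M\|x-y\|$ for some $M$ and all $x,y\in[0,1]^d$, then $\mathrm{Var}(\hat\mu_n)=O(n^{-1-2/d})$: there is a constant $C$ (not depending on $n$) with $\mathrm{Var}(\hat\mu_n)\le C n^{-1-2/d}$ for all $n\ge1$. 3. If $f=g\,1_\Omega$, where $g$ is Lipschitz continuous on $[0,1]^d$ and $\Omega\subseteq[0,1]^d$ is a set whose boundary $\partial\Omega$ (in $\mathbb{R}^d$) admits $(d-1)$-dimensional Minkowski content, i.e. the limit $$\lim_{\epsilon\downarrow0}\frac{\lambda_d(\{x\in\mathbb{R}^d:\mathrm{dist}(x,\partial\Omega)\le\epsilon\})}{2\epsilon}$$ exists and is finite, then $\mathrm{Var}(\hat\mu_n)=O(n^{-1-1/d})$: there is a constant $C$ (not depending on $n$) with $\mathrm{Var}(\hat\mu_n)\le C n^{-1-1/d}$ for all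 $n\ge1$. (For $\Omega=\emptyset$, $\mathrm{dist}(x,\emptyset)=\infty$.) -/

import Mathlib

open MeasureTheory ProbabilityTheory Filter Topology Set
open scoped ENNReal NNReal

universe u

noncomputable section

/-- The unit cube `[0,1]^d` in Euclidean space. -/
def unitCube (d : ℕ) : Set (EuclideanSpace ℝ (Fin d)) :=
  {x | ∀ j, x j ∈ Icc (0 : ℝ) 1}

/-- The closed dyadic subcube `∏ j, [κ j / 2^m, (κ j + 1) / 2^m]`. -/
def dyadicCube (d m : ℕ) (κ : Fin d → ℕ) : Set (EuclideanSpace ℝ (Fin d)) :=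
  {x | ∀ j, x j ∈ Icc ((κ j : ℝ) / 2 ^ m) (((κ j : ℝ) + 1) / 2 ^ m)}

/-- The lower corner of `dyadicCube d m κ`. -/
def dyadicCorner (d m : ℕ) (κ : Fin d → ℕ) : EuclideanSpace ℝ (Fin d) :=
  WithLp.toLp 2 fun j => (κ j : ℝ) / 2 ^ m

/-- The dyadic subcubes of equal level with indices `κ` and `κ'` are distinct and have a
`(d-1)`-dimensional face in common: one is the translate of the other by one side length along
a single coordinate axis. -/
def AdjacentIndex {d : ℕ} (κ κ' : Fin d → ℕ) : Prop :=
  ∃ j, (κ j + 1 = κ' j ∨ κ' j + 1 = κ j) ∧ ∀ i, i ≠ j → κ i = κ' i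

/-- A sequence of mappings `H_m`, `m ≥ 0`, generating a Hilbert curve in dimension `d`.
`H_m` sends the interval `[k / 2^(d m), (k + 1) / 2^(d m)]`, `k < 2^(d m)`, to the dyadic subcube
`dyadicCube d m (idx m k)` of `[0,1]^d`. (The values `idx m k` for `k ≥ 2^(d m)` are irrelevant.) -/
structure HilbertSequence (d : ℕ) where
  /-- The index of the subcube `H_m` assigns to the `k`-th interval of level `m`. -/
  idx : ℕ → ℕ → Fin d → ℕ
  /-- The values of `H_m` are subcubes of `[0,1]^d`. -/
  idx_lt : ∀ m k, k < 2 ^ (d * m) → ∀ j, idx m k j < 2 ^ m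
  /-- Bijection. -/
  bijection : ∀ m k k', k < 2 ^ (d * m) → k' < 2 ^ (d * m) → k ≠ k' →
    dyadicCube d m (idx m k) ≠ dyadicCube d m (idx m k')
  /-- Adjacency. -/
  adjacency : ∀ m k, k + 1 < 2 ^ (d * m) → AdjacentIndex (idx m k) (idx m (k + 1))
  /-- Nesting: the `2^d` successive subintervals of the `k`-th interval of level `m` are sent to
  subcubes whose union is the subcube of the `k`-th interval. -/
  nesting : ∀ m k, k < 2 ^ (d * m) →
    (⋃ l ∈ Finset.range (2 ^ d), dyadicCube d (m + 1) (idx (m + 1) (2 ^ d * k + l))) =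
      dyadicCube d m (idx m k)

/-- For `x ∈ [0,1]`, the index `k < 2^(d m)` of an interval `[k / 2^(d m), (k + 1) / 2^(d m)]`
that contains `x` (the right one of the two if `x` is a common endpoint). -/
def intervalIndex (d m : ℕ) (x : ℝ) : ℕ :=
  min ⌊(2 : ℝ) ^ (d * m) * x⌋₊ (2 ^ (d * m) - 1)

/-- The Hilbert curve `H(x) = lim H_m(x)`, `x ∈ [0,1]`: the point to which the subcubes assigned
by `H_m` to the intervals of level `m` around `x` shrink as `m → ∞`. Their diameters tend to `0`,
so this is the limit of their lower corners. -/
def HilbertSequence.curve {d : ℕ} (S : HilbertSequence d) (x : ℝ) : EuclideanSpace ℝ (Fin d) :=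
  limUnder atTop fun m : ℕ => dyadicCorner d m (S.idx m (intervalIndex d m x))

/-- Lipschitz continuity on `[0,1]^d` with respect to the Euclidean norm. -/
def LipschitzOnCube {d : ℕ} (f : EuclideanSpace ℝ (Fin d) → ℝ) : Prop :=
  ∃ M : ℝ, ∀ x ∈ unitCube d, ∀ y ∈ unitCube d, |f x - f y| ≤ M * ‖x - y‖

/-- The boundary of `Ω` (in `ℝ^d`) admits `(d-1)`-dimensional Minkowski content: the limit of
`λ_d {x | dist(x, ∂Ω) ≤ ε} / (2 ε)` for `ε ↓ 0` exists and is finite. -/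
def AdmitsMinkowskiContent {d : ℕ} (Ω : Set (EuclideanSpace ℝ (Fin d))) : Prop :=
  ∃ M : ℝ≥0, Tendsto
    (fun ε : ℝ => volume (Metric.cthickening ε (frontier Ω)) / ENNReal.ofReal (2 * ε))
    (𝓝[>] 0) (𝓝 (M : ℝ≥0∞))

/-- `Δ_1, …, Δ_n` are independent and uniformly distributed on `[0,1]`. -/
def IsIIDUniform {T : Type*} [MeasurableSpace T] (P : Measure T) {n : ℕ}
    (Δ : Fin n → T → ℝ) : Prop :=
  iIndepFun Δ P ∧ ∀ i, pdf.IsUniform (Δ i) (Icc (0 : ℝ) 1) P volume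

/-- The estimate `(1/n) ∑ f(H(x_i))` with `x_i = (i - 1 + Δ_i) / n`, `i = 1, …, n`
(the index of `Fin n` is `i - 1`). -/
def latticeEstimate {d n : ℕ} (H : ℝ → EuclideanSpace ℝ (Fin d))
    (f : EuclideanSpace ℝ (Fin d) → ℝ) (Δ : Fin n → ℝ) : ℝ :=
  (1 / (n : ℝ)) * ∑ i : Fin n, f (H (((i : ℕ) + Δ i) / n))

end

/-!
The variance bounds rest on two properties of the Hilbert curve `H`. It is Hölder continuous with
exponent `1 / d` (`HilbertSequence.norm_curve_sub_le`): intervals of length `2 ^ (-d m)` are sent to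
cubes of side `2 ^ (-m)`, and neighbouring intervals to cubes with a common face. It also pushes the
uniform distribution on `[0,1]` forward to that on `[0,1]^d`
(`HilbertSequence.measurePreserving_curve`): at each level `m`, the index of the cube visited at a
uniform time and the index of the cube around a uniform point are both uniform, since `H_m` is a
bijection, and integrals of bounded continuous functions follow by letting `m → ∞`.

With `F = f ∘ H` the estimator is a stratified one on `[0,1]`: its `i`-th node is uniform on the
`i`-th of `n` strata of length `1 / n`. The mean is then `∫ F = ∫ f`, and by independence the
variance is `n⁻²` times the sum of the variances in the strata, each at most the square of the
oscillation of `F` there (`IsIIDUniform.variance_estimate_le`). For Lipschitz `f` the oscillation is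
`O(n ^ (-1 / d))`, which gives `O(n ^ (-1 - 2 / d))`.

For `f = g 1_Ω` this remains true in the strata that `H` maps into `Ω` or into its complement. In the
other strata the oscillation is bounded, and the curve stays within `O(n ^ (-1 / d))` of `∂Ω`, as a
segment from a point of `Ω` to a point outside it meets `∂Ω`. Since `H` preserves measure, the
Minkowski content bounds the number of these strata by `O(n ^ (1 - 1 / d))`
(`HilbertSequence.ncard_crossing_le`), which gives `O(n ^ (-1 - 1 / d))`.
-/

/-! ### Clamped floor indices -/

/-- The index `k < N` of an interval `[k / N, (k + 1) / N]` around `t ∈ [0,1]`; numbers outside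
`[0,1]` are given the first or the last index. -/
noncomputable def floorIndex (N : ℕ) (t : ℝ) : ℕ :=
  min ⌊(N : ℝ) * t⌋₊ (N - 1)

lemma floorIndex_lt {N : ℕ} (hN : 0 < N) (t : ℝ) : floorIndex N t < N :=
  (min_le_right _ _).trans_lt (by omega)

lemma measurable_floorIndex (N : ℕ) : Measurable (floorIndex N) := by
  unfold floorIndex
  exact (Nat.measurable_floor.comp (measurable_const.mul measurable_id)).min measurable_const

lemma intervalIndex_eq (d m : ℕ) (x : ℝ) : intervalIndex d m x = floorIndex (2 ^ (d * m)) x := by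
  simp [intervalIndex, floorIndex]

lemma measurable_intervalIndex (d m : ℕ) : Measurable (intervalIndex d m) := by
  rw [show intervalIndex d m = floorIndex (2 ^ (d * m)) from funext (intervalIndex_eq d m)]
  exact measurable_floorIndex _

lemma Ico_subset_floorIndex {N k : ℕ} (hk : k < N) :
    Ico ((k : ℝ) / N) ((k + 1) / N) ⊆ Icc 0 1 ∩ floorIndex N ⁻¹' {k} := by
  have hN : (0 : ℝ) < N := by exact_mod_cast (Nat.zero_le k).trans_lt hk
  rintro t ⟨h1, h2⟩
  have hk' : (k : ℝ) + 1 ≤ N := by exact_mod_cast hk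
  have h0 : 0 ≤ t := le_trans (by positivity) h1
  refine ⟨⟨h0, h2.le.trans ((div_le_one hN).2 hk')⟩, ?_⟩
  rw [div_le_iff₀ hN] at h1
  rw [lt_div_iff₀ hN] at h2
  have : ⌊(N : ℝ) * t⌋₊ = k := by
    rw [Nat.floor_eq_iff (by positivity)]
    constructor <;> linarith
  simp only [mem_preimage, floorIndex, this, mem_singleton_iff]
  omega

lemma floorIndex_subset_Icc {N k : ℕ} (hN : 0 < N) :
    Icc 0 1 ∩ floorIndex N ⁻¹' {k} ⊆ Icc ((k : ℝ) / N) ((k + 1) / N) := by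
  have hN' : (0 : ℝ) < N := by exact_mod_cast hN
  rintro t ⟨⟨h0, h1⟩, h⟩
  have hN1 : ((N - 1 : ℕ) : ℝ) = N - 1 := by push_cast [Nat.one_le_iff_ne_zero.2 hN.ne']; ring
  have hp : (0 : ℝ) ≤ N * t := by positivity
  have hfl := Nat.floor_le hp
  have hfl' := Nat.lt_floor_add_one ((N : ℝ) * t)
  simp only [mem_preimage, floorIndex, mem_singleton_iff] at h
  rw [mem_Icc, div_le_iff₀ hN', le_div_iff₀ hN']
  rcases le_total ⌊(N : ℝ) * t⌋₊ (N - 1) with hle | hle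
  · rw [min_eq_left hle] at h
    rw [h] at hfl hfl'
    constructor <;> linarith
  · rw [min_eq_right hle] at h
    have : ((N - 1 : ℕ) : ℝ) ≤ (⌊(N : ℝ) * t⌋₊ : ℝ) := by exact_mod_cast hle
    rw [← h]
    rw [hN1] at this ⊢
    constructor <;> nlinarith

/-- The set lies between a half-open and a closed interval with the same endpoints. -/
lemma volume_floorIndex {N k : ℕ} (hk : k < N) :
    volume (Icc 0 1 ∩ floorIndex N ⁻¹' {k}) = ENNReal.ofReal (1 / N) := by
  have hN : (N : ℝ) ≠ 0 := by
    have : N ≠ 0 := by omega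
    exact_mod_cast this
  have e : ((k : ℝ) + 1) / N - k / N = 1 / N := by ring
  apply le_antisymm
  · refine (measure_mono (floorIndex_subset_Icc (by omega))).trans ?_
    rw [Real.volume_Icc, e]
  · refine le_trans ?_ (measure_mono (Ico_subset_floorIndex hk))
    rw [Real.volume_Ico, e]

/-- The interval of the finer partition around a point lies in that of the coarser one. -/
lemma floorIndex_mul_div {N q : ℕ} (hN : 0 < N) (hq : 0 < q) (t : ℝ) :
    floorIndex (N * q) t / q = floorIndex N t := by
  have h : ⌊((N * q : ℕ) : ℝ) * t⌋₊ / q = ⌊(N : ℝ) * t⌋₊ := by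
    rw [← Nat.floor_div_natCast]
    congr 1
    push_cast
    field_simp
  have h2 : (N * q - 1) / q = N - 1 := by
    obtain ⟨M, rfl⟩ : ∃ M, N = M + 1 := ⟨N - 1, by omega⟩
    have : (M + 1) * q - 1 = (q - 1) + q * M := by
      rw [add_mul, one_mul, mul_comm]; omega
    rw [this, Nat.add_mul_div_left _ _ hq, Nat.div_eq_of_lt (by omega)]
    simp
  unfold floorIndex
  rw [← h, ← h2]
  exact (Monotone.map_min (f := fun a => a / q) fun a b hab => Nat.div_le_div_right hab)

lemma floorIndex_mono (N : ℕ) : Monotone (floorIndex N) := fun _ _ h =>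
  min_le_min_right _ (Nat.floor_le_floor (mul_le_mul_of_nonneg_left h (by positivity)))

/-- Points at distance at most `1 / N` lie in equal or neighbouring intervals. -/
lemma floorIndex_le_add_one {N : ℕ} {x y : ℝ} (hx : 0 ≤ x) (hxy : N * y ≤ N * x + 1) :
    floorIndex N y ≤ floorIndex N x + 1 := by
  have h : ⌊(N : ℝ) * y⌋₊ ≤ ⌊(N : ℝ) * x⌋₊ + 1 := by
    rw [← Nat.floor_add_one (by positivity)]
    exact Nat.floor_le_floor hxy
  unfold floorIndex
  omega

/-! ### The Hilbert curve: convergence and Hölder continuity -/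

lemma norm_le_of_forall_coord_le {d : ℕ} {z : EuclideanSpace ℝ (Fin d)} {r : ℝ} (hr : 0 ≤ r)
    (h : ∀ j, |z j| ≤ r) : ‖z‖ ≤ √d * r := by
  rw [EuclideanSpace.norm_eq]
  apply Real.sqrt_le_iff.2
  refine ⟨by positivity, ?_⟩
  rw [mul_pow, Real.sq_sqrt (by positivity)]
  calc ∑ j, ‖z j‖ ^ 2 ≤ ∑ _j : Fin d, r ^ 2 :=
        Finset.sum_le_sum fun j _ => pow_le_pow_left₀ (norm_nonneg _) (h j) 2
    _ = d * r ^ 2 := by simp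

lemma abs_sub_le_of_mem_dyadicCube {d m : ℕ} {κ : Fin d → ℕ} {x y : EuclideanSpace ℝ (Fin d)}
    (hx : x ∈ dyadicCube d m κ) (hy : y ∈ dyadicCube d m κ) (j : Fin d) :
    |(x - y) j| ≤ 1 / 2 ^ m := by
  have h1 := hx j
  have h2 := hy j
  have e : ((κ j : ℝ) + 1) / 2 ^ m = κ j / 2 ^ m + 1 / 2 ^ m := by ring
  rw [mem_Icc, e] at h1 h2
  rw [PiLp.sub_apply, abs_le]
  constructor <;> linarith [h1.1, h1.2, h2.1, h2.2]

lemma dyadicCorner_mem (d m : ℕ) (κ : Fin d → ℕ) : dyadicCorner d m κ ∈ dyadicCube d m κ := by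
  intro j
  simp only [dyadicCorner, mem_Icc, le_refl, true_and]
  gcongr
  linarith

lemma isClosed_dyadicCube (d m : ℕ) (κ : Fin d → ℕ) : IsClosed (dyadicCube d m κ) := by
  have : dyadicCube d m κ =
      ⋂ j, (fun x : EuclideanSpace ℝ (Fin d) => x j) ⁻¹'
        Icc ((κ j : ℝ) / 2 ^ m) (((κ j : ℝ) + 1) / 2 ^ m) := by
    ext; simp [dyadicCube]
  rw [this]
  exact isClosed_iInter fun j => isClosed_Icc.preimage (by fun_prop)

namespace HilbertSequence

variable {d : ℕ} (S : HilbertSequence d)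

/-- The lower corner of the subcube that `H_m` assigns to the interval around `x`. -/
noncomputable def corner (m : ℕ) (x : ℝ) : EuclideanSpace ℝ (Fin d) :=
  dyadicCorner d m (S.idx m (intervalIndex d m x))

/-- The subcube that `H_m` assigns to the interval around `x`. -/
def cubeAt (m : ℕ) (x : ℝ) : Set (EuclideanSpace ℝ (Fin d)) :=
  dyadicCube d m (S.idx m (intervalIndex d m x))

lemma intervalIndex_lt (m : ℕ) (x : ℝ) : intervalIndex d m x < 2 ^ (d * m) := by
  rw [intervalIndex_eq]
  exact floorIndex_lt (by positivity) x

/-- Dividing the interval index at level `m + 1` by `2 ^ d` gives that at level `m`, so the nesting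
condition applies to the two cubes. No condition on `x` is needed, as the indices are clamped. -/
lemma cubeAt_succ_subset (m : ℕ) (x : ℝ) : S.cubeAt (m + 1) x ⊆ S.cubeAt m x := by
  have h : intervalIndex d (m + 1) x / 2 ^ d = intervalIndex d m x := by
    rw [intervalIndex_eq, intervalIndex_eq, mul_add, mul_one, pow_add]
    exact floorIndex_mul_div (by positivity) (by positivity) x
  unfold cubeAt
  rw [← S.nesting m _ (intervalIndex_lt m x), ← h]
  conv_lhs => rw [← Nat.div_add_mod (intervalIndex d (m + 1) x) (2 ^ d)]
  exact subset_biUnion_of_mem (u := fun l => dyadicCube d (m + 1)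
    (S.idx (m + 1) (2 ^ d * (intervalIndex d (m + 1) x / 2 ^ d) + l)))
    (Finset.mem_coe.2 (Finset.mem_range.2 (Nat.mod_lt _ (by positivity))))

lemma antitone_cubeAt (x : ℝ) : Antitone fun m => S.cubeAt m x :=
  antitone_nat_of_succ_le fun m => S.cubeAt_succ_subset m x

lemma corner_mem (m : ℕ) (x : ℝ) : S.corner m x ∈ S.cubeAt m x := dyadicCorner_mem _ _ _

lemma tendsto_corner (x : ℝ) : Tendsto (fun m => S.corner m x) atTop (𝓝 (S.curve x)) := by
  have : CauchySeq fun m => S.corner m x := by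
    refine cauchySeq_of_le_geometric (1 / 2) (√d) (by norm_num) fun m => ?_
    rw [dist_eq_norm]
    refine (norm_le_of_forall_coord_le (r := 1 / 2 ^ m) (by positivity) fun j => ?_).trans ?_
    · exact abs_sub_le_of_mem_dyadicCube (S.corner_mem m x)
        (S.cubeAt_succ_subset m x (S.corner_mem (m + 1) x)) j
    · simp
  exact this.tendsto_limUnder

lemma curve_mem_cubeAt (m : ℕ) (x : ℝ) : S.curve x ∈ S.cubeAt m x :=
  (isClosed_dyadicCube _ _ _).mem_of_tendsto (S.tendsto_corner x)
    (eventually_atTop.2 ⟨m, fun _ hb => S.antitone_cubeAt x hb (S.corner_mem _ x)⟩)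

lemma curve_mem_unitCube (x : ℝ) : S.curve x ∈ unitCube d := by
  intro j
  have h := S.curve_mem_cubeAt 0 x j
  have h0 : S.idx 0 (intervalIndex d 0 x) j = 0 := by
    have := S.idx_lt 0 _ (intervalIndex_lt 0 x) j
    simpa using this
  simpa [h0] using h

lemma measurable_corner (m : ℕ) : Measurable (S.corner m) :=
  (measurable_from_nat (f := fun k => dyadicCorner d m (S.idx m k))).comp
    (measurable_intervalIndex d m)

lemma measurable_curve : Measurable S.curve :=
  measurable_of_tendsto_metrizable (fun m => S.measurable_corner m)
    (tendsto_pi_nhds.2 S.tendsto_corner)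

/-- Points in the same or in neighbouring intervals of level `m` are sent to the same cube or to
cubes with a common face, in which each coordinate varies by at most two side lengths. -/
lemma norm_curve_sub_le_level {m : ℕ} {x y : ℝ} (hx : 0 ≤ x) (hxy : x ≤ y)
    (h : 2 ^ (d * m) * (y - x) ≤ 1) : ‖S.curve x - S.curve y‖ ≤ √d * (2 / 2 ^ m) := by
  refine norm_le_of_forall_coord_le (by positivity) fun j => ?_
  have h1 : intervalIndex d m x ≤ intervalIndex d m y := by
    simp only [intervalIndex_eq]
    exact floorIndex_mono _ hxy
  have h2 : intervalIndex d m y ≤ intervalIndex d m x + 1 := by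
    simp only [intervalIndex_eq]
    refine floorIndex_le_add_one hx ?_
    push_cast
    linarith
  have hj : |((S.idx m (intervalIndex d m x) j : ℝ)) - S.idx m (intervalIndex d m y) j| ≤ 1 := by
    obtain e | e : intervalIndex d m y = intervalIndex d m x ∨
        intervalIndex d m y = intervalIndex d m x + 1 := by omega
    · simp [e]
    · obtain ⟨i, hi, hne⟩ := S.adjacency m (intervalIndex d m x) (e ▸ intervalIndex_lt m y)
      rw [e]
      by_cases hji : j = i
      · subst hji
        rcases hi with hi | hi <;> rw [← hi] <;> push_cast <;> simp
      · simp [hne j hji]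
  have a := S.curve_mem_cubeAt m x j
  have b := S.curve_mem_cubeAt m y j
  have hp : (0 : ℝ) < 2 ^ m := by positivity
  rw [mem_Icc, div_le_iff₀ hp, le_div_iff₀ hp] at a b
  rw [PiLp.sub_apply, abs_le]
  rw [abs_le] at hj
  constructor
  · rw [← neg_div, div_le_iff₀ hp]
    linarith
  · rw [le_div_iff₀ hp]
    linarith

/-- The Hilbert curve is Hölder continuous with exponent `1 / d`. It is stated for points at
distance at most `1 / n`, as it is applied to the strata of length `1 / n`. -/
lemma norm_curve_sub_le (hd : 1 ≤ d) {n : ℕ} (hn : 1 ≤ n) {x y : ℝ} (hx : 0 ≤ x) (hy : 0 ≤ y)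
    (h : n * |x - y| ≤ 1) : ‖S.curve x - S.curve y‖ ≤ 4 * √d * (n : ℝ) ^ (-1 / (d : ℝ)) := by
  wlog hxy : x ≤ y generalizing x y
  · rw [norm_sub_rev]
    exact this hy hx (by rwa [abs_sub_comm]) (le_of_not_ge hxy)
  -- `m` is the level with `2 ^ (d * m) ≤ n < 2 ^ (d * (m + 1))`: its intervals are at least as long
  -- as `1 / n`, and its cubes have side less than `2 * n ^ (-1 / d)`
  set m := Nat.log (2 ^ d) n with hm
  have h2d : 1 < 2 ^ d := Nat.one_lt_two_pow (by omega)
  have hlo : 2 ^ (d * m) ≤ n := by rw [pow_mul]; exact Nat.pow_log_le_self _ (by omega)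
  have hhi : n < 2 ^ (d * (m + 1)) := by rw [pow_mul]; exact Nat.lt_pow_succ_log_self h2d n
  have hn0 : (0 : ℝ) < n := by exact_mod_cast hn
  have hd0 : (d : ℝ) ≠ 0 := by positivity
  refine (S.norm_curve_sub_le_level (m := m) hx hxy ?_).trans ?_
  · rw [abs_sub_comm, abs_of_nonneg (sub_nonneg.2 hxy)] at h
    refine le_trans (mul_le_mul_of_nonneg_right ?_ (sub_nonneg.2 hxy)) h
    exact_mod_cast hlo
  · have hroot : (n : ℝ) ^ (1 / (d : ℝ)) ≤ 2 ^ (m + 1) := by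
      calc (n : ℝ) ^ (1 / (d : ℝ)) ≤ ((2 ^ (m + 1)) ^ d : ℝ) ^ (1 / (d : ℝ)) := by
            refine Real.rpow_le_rpow hn0.le ?_ (by positivity)
            rw [← pow_mul, mul_comm (m + 1)]
            exact_mod_cast hhi.le
        _ = 2 ^ (m + 1) := by
            rw [one_div, Real.pow_rpow_inv_natCast (by positivity) (by omega)]
    have hpos : 0 < (n : ℝ) ^ (1 / (d : ℝ)) := by positivity
    rw [neg_div, Real.rpow_neg hn0.le, ← div_eq_mul_inv, mul_comm (4 : ℝ), mul_div_assoc]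
    refine mul_le_mul_of_nonneg_left ?_ (by positivity)
    rw [div_le_div_iff₀ (by positivity) hpos]
    rw [pow_succ] at hroot
    linarith

end HilbertSequence

/-! ### The Hilbert curve preserves Lebesgue measure -/

/-- The lower corner of the level-`m` dyadic subcube around a point of the unit cube. -/
noncomputable def roundDown (d m : ℕ) (y : EuclideanSpace ℝ (Fin d)) : EuclideanSpace ℝ (Fin d) :=
  dyadicCorner d m fun j => floorIndex (2 ^ m) (y j)

lemma measurable_floorIndex_coord (d m : ℕ) :
    Measurable fun (y : EuclideanSpace ℝ (Fin d)) (j : Fin d) => floorIndex (2 ^ m) (y j) :=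
  measurable_pi_lambda _ fun _ => (measurable_floorIndex _).comp (by fun_prop)

lemma measurable_dyadicCorner (d m : ℕ) : Measurable (dyadicCorner d m) :=
  measurable_of_countable _

lemma tendsto_roundDown {y : EuclideanSpace ℝ (Fin d)} (hy : y ∈ unitCube d) :
    Tendsto (fun m => roundDown d m y) atTop (𝓝 y) := by
  have hmem (m : ℕ) : y ∈ dyadicCube d m fun j => floorIndex (2 ^ m) (y j) := fun j => by
    have := floorIndex_subset_Icc (N := 2 ^ m) (by positivity) ⟨hy j, rfl⟩
    push_cast at this
    exact this
  rw [tendsto_iff_norm_sub_tendsto_zero]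
  refine squeeze_zero (fun _ => norm_nonneg _) (fun m => norm_le_of_forall_coord_le
    (r := 1 / 2 ^ m) (by positivity) fun j =>
      abs_sub_le_of_mem_dyadicCube (dyadicCorner_mem _ _ _) (hmem m) j) ?_
  have : Tendsto (fun m : ℕ => √d * (1 / 2 : ℝ) ^ m) atTop (𝓝 (√d * 0)) :=
    (tendsto_pow_atTop_nhds_zero_of_lt_one (by norm_num) (by norm_num)).const_mul _
  simpa using this

lemma volume_floorIndex_coord {d m : ℕ} {κ : Fin d → ℕ} (hκ : ∀ j, κ j < 2 ^ m) :
    volume (unitCube d ∩ (fun y j => floorIndex (2 ^ m) (y j)) ⁻¹' {κ}) =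
      ENNReal.ofReal (1 / 2 ^ (d * m)) := by
  have e : unitCube d ∩ (fun y j => floorIndex (2 ^ m) (y j)) ⁻¹' {κ} =
      (@WithLp.ofLp 2 (Fin d → ℝ)) ⁻¹'
        univ.pi fun j => Icc 0 1 ∩ floorIndex (2 ^ m) ⁻¹' {κ j} := by
    ext y
    simp only [unitCube, mem_inter_iff, mem_ofPred_eq, mem_preimage, mem_singleton_iff, funext_iff,
      mem_univ_pi, forall_and]
  rw [e, (PiLp.volume_preserving_ofLp (Fin d)).measure_preimage
    (MeasurableSet.univ_pi fun j => measurableSet_Icc.inter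
      (measurable_floorIndex _ (measurableSet_singleton _))).nullMeasurableSet, volume_pi_pi]
  simp_rw [volume_floorIndex (hκ _)]
  rw [Finset.prod_const, Finset.card_univ, Fintype.card_fin,
    ← ENNReal.ofReal_pow (by positivity)]
  congr 1
  push_cast
  rw [one_div_pow, ← pow_mul, mul_comm]

namespace HilbertSequence

variable {d : ℕ} (S : HilbertSequence d)

/-- `H_m` is onto: it is an injective map between sets of `2 ^ (d * m)` elements. -/
lemma exists_idx_eq {m : ℕ} {κ : Fin d → ℕ} (hκ : ∀ j, κ j < 2 ^ m) :
    ∃ k < 2 ^ (d * m), S.idx m k = κ := by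
  let φ : Fin (2 ^ (d * m)) → (Fin d → Fin (2 ^ m)) := fun k j =>
    ⟨S.idx m k j, S.idx_lt m k k.2 j⟩
  have hinj : Function.Injective φ := by
    intro k k' h
    by_contra hne
    refine S.bijection m k k' k.2 k'.2 (fun h => hne (Fin.ext h)) ?_
    congr 1
    funext j
    simpa [φ] using congrArg Fin.val (congrFun h j)
  have hsurj : Function.Surjective φ := by
    refine ((Fintype.bijective_iff_injective_and_card φ).2 ⟨hinj, ?_⟩).2
    simp [pow_mul, mul_comm d m]
  obtain ⟨k, hk⟩ := hsurj fun j => ⟨κ j, hκ j⟩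
  exact ⟨k, k.2, funext fun j => congrArg Fin.val (congrFun hk j)⟩

lemma idx_injOn {m k k' : ℕ} (hk : k < 2 ^ (d * m)) (hk' : k' < 2 ^ (d * m))
    (h : S.idx m k = S.idx m k') : k = k' := by
  by_contra hne
  exact S.bijection m k k' hk hk' hne (by rw [h])

/-- At every dyadic level, the index of the subcube that the curve visits at a uniformly distributed
time has the law of the index of the subcube around a uniformly distributed point. -/
lemma map_corner (m : ℕ) : (volume.restrict (Icc (0 : ℝ) 1)).map (S.corner m) =
    (volume.restrict (unitCube d)).map (roundDown d m) := by
  have hI : Measurable fun x => S.idx m (intervalIndex d m x) :=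
    (measurable_from_nat (f := S.idx m)).comp (measurable_intervalIndex d m)
  have hR := measurable_floorIndex_coord d m
  have key : (volume.restrict (Icc (0 : ℝ) 1)).map (fun x => S.idx m (intervalIndex d m x)) =
      (volume.restrict (unitCube d)).map (fun y j => floorIndex (2 ^ m) (y j)) := by
    refine Measure.ext_of_singleton fun κ => ?_
    rw [Measure.map_apply hI (measurableSet_singleton κ),
      Measure.map_apply hR (measurableSet_singleton κ),
      Measure.restrict_apply (hI (measurableSet_singleton κ)),
      Measure.restrict_apply (hR (measurableSet_singleton κ)), inter_comm, inter_comm _ (unitCube d)]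
    by_cases hκ : ∀ j, κ j < 2 ^ m
    · rw [volume_floorIndex_coord hκ]
      obtain ⟨k, hk, rfl⟩ := S.exists_idx_eq hκ
      have e : (fun x => S.idx m (intervalIndex d m x)) ⁻¹' {S.idx m k} =
          floorIndex (2 ^ (d * m)) ⁻¹' {k} := by
        ext x
        simp only [mem_preimage, mem_singleton_iff, ← intervalIndex_eq]
        exact ⟨S.idx_injOn (intervalIndex_lt m x) hk, fun h => by rw [h]⟩
      rw [e, volume_floorIndex hk]
      push_cast
      rfl
    · have e1 : (fun x => S.idx m (intervalIndex d m x)) ⁻¹' {κ} = ∅ := by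
        refine eq_empty_of_forall_notMem fun x hx => hκ fun j => ?_
        rw [← mem_singleton_iff.1 hx]
        exact S.idx_lt m _ (intervalIndex_lt m x) j
      have e2 : (fun (y : EuclideanSpace ℝ (Fin d)) (j : Fin d) =>
          floorIndex (2 ^ m) (y j)) ⁻¹' {κ} = ∅ := by
        refine eq_empty_of_forall_notMem fun x hx => hκ fun j => ?_
        rw [← mem_singleton_iff.1 hx]
        exact floorIndex_lt (by positivity) _
      rw [e1, e2]
      simp
  have h := congrArg (Measure.map (dyadicCorner d m)) key
  rwa [Measure.map_map (measurable_dyadicCorner d m) hI,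
    Measure.map_map (measurable_dyadicCorner d m) hR] at h

end HilbertSequence

lemma isClosed_unitCube (d : ℕ) : IsClosed (unitCube d) := by
  have : unitCube d = ⋂ j, (fun x : EuclideanSpace ℝ (Fin d) => x j) ⁻¹' Icc 0 1 := by
    ext; simp [unitCube]
  rw [this]
  exact isClosed_iInter fun j => isClosed_Icc.preimage (by fun_prop)

lemma volume_unitCube (d : ℕ) : volume (unitCube d) = 1 := by
  have e : unitCube d = (@WithLp.ofLp 2 (Fin d → ℝ)) ⁻¹' univ.pi fun _ => Icc 0 1 := by
    ext y
    simp only [unitCube, mem_ofPred_eq, mem_preimage, mem_univ_pi]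
  rw [e, (PiLp.volume_preserving_ofLp (Fin d)).measure_preimage
    (MeasurableSet.univ_pi fun j => measurableSet_Icc).nullMeasurableSet, volume_pi_pi]
  simp

instance (d : ℕ) : IsProbabilityMeasure (volume.restrict (unitCube d)) :=
  ⟨by simp [volume_unitCube]⟩

instance : IsProbabilityMeasure (volume.restrict (Icc (0 : ℝ) 1)) :=
  ⟨by simp⟩

namespace HilbertSequence

variable {d : ℕ} (S : HilbertSequence d)

/-- The Hilbert curve pushes the uniform distribution on `[0,1]` forward to that on `[0,1]^d`: the
level-`m` approximations of the two laws agree, and both converge weakly. -/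
lemma measurePreserving_curve : MeasurePreserving S.curve (volume.restrict (Icc (0 : ℝ) 1))
    (volume.restrict (unitCube d)) := by
  refine ⟨S.measurable_curve, ?_⟩
  have : IsFiniteMeasure ((volume.restrict (Icc (0 : ℝ) 1)).map S.curve) :=
    Measure.isFiniteMeasure_map _ _
  refine ext_of_forall_integral_eq_of_IsFiniteMeasure fun φ => ?_
  have hround (m : ℕ) : Measurable (roundDown d m) :=
    (measurable_dyadicCorner d m).comp (measurable_floorIndex_coord d m)
  have hφ : Measurable φ := φ.continuous.measurable
  have hlim1 : Tendsto (fun m => ∫ x in Icc (0 : ℝ) 1, φ (S.corner m x)) atTop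
      (𝓝 (∫ x in Icc (0 : ℝ) 1, φ (S.curve x))) :=
    tendsto_integral_of_dominated_convergence (fun _ => ‖φ‖)
      (fun m => (hφ.comp (S.measurable_corner m)).aestronglyMeasurable) (integrable_const _)
      (fun m => ae_of_all _ fun x => φ.norm_coe_le_norm _)
      (ae_of_all _ fun x => (φ.continuous.tendsto _).comp (S.tendsto_corner x))
  have hlim2 : Tendsto (fun m => ∫ y in unitCube d, φ (roundDown d m y)) atTop
      (𝓝 (∫ y in unitCube d, φ y)) :=
    tendsto_integral_of_dominated_convergence (fun _ => ‖φ‖)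
      (fun m => (hφ.comp (hround m)).aestronglyMeasurable) (integrable_const _)
      (fun m => ae_of_all _ fun x => φ.norm_coe_le_norm _)
      ((ae_restrict_iff' (isClosed_unitCube d).measurableSet).2 (ae_of_all _ fun y hy =>
        (φ.continuous.tendsto _).comp (tendsto_roundDown hy)))
  have heq (m : ℕ) : ∫ x in Icc (0 : ℝ) 1, φ (S.corner m x) =
      ∫ y in unitCube d, φ (roundDown d m y) := by
    rw [← integral_map (S.measurable_corner m).aemeasurable hφ.aestronglyMeasurable,
      S.map_corner m, integral_map (hround m).aemeasurable hφ.aestronglyMeasurable]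
  rw [integral_map S.measurable_curve.aemeasurable hφ.aestronglyMeasurable]
  simp_rw [heq] at hlim1
  exact tendsto_nhds_unique hlim1 hlim2

end HilbertSequence

/-! ### Stratified sampling on the unit interval -/

/-- The affine map onto the `i`-th of `n` strata sends the uniform distribution on `[0,1]` to that
on the stratum, whose density is `n`. -/
lemma map_stratum {n : ℕ} (hn : 1 ≤ n) (i : ℕ) :
    (volume.restrict (Icc (0 : ℝ) 1)).map (fun u : ℝ => ((i : ℝ) + u) / n) =
      ENNReal.ofReal n • volume.restrict (Icc ((i : ℝ) / n) ((i + 1) / n)) := by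
  have hn0 : (0 : ℝ) < n := by exact_mod_cast hn
  have hm : Measurable fun u : ℝ => (i + u) / n := by fun_prop
  have hvol : volume.map (fun u : ℝ => (i + u) / n) = ENNReal.ofReal n • volume := by
    have e : (fun u : ℝ => (i + u) / n) = ((n : ℝ)⁻¹ * ·) ∘ ((i : ℝ) + ·) := by
      funext u
      simp only [Function.comp_apply]
      ring
    rw [e, ← Measure.map_map (by fun_prop) (by fun_prop), map_add_left_eq_self,
      Real.map_volume_mul_left (by positivity), inv_inv, abs_of_pos hn0]
  have hpre : (fun u : ℝ => (i + u) / n) ⁻¹' Icc ((i : ℝ) / n) ((i + 1) / n) = Icc 0 1 := by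
    ext u
    simp only [mem_preimage, mem_Icc, div_le_div_iff_of_pos_right hn0]
    constructor <;> rintro ⟨h1, h2⟩ <;> constructor <;> linarith
  rw [← Measure.restrict_smul, ← hvol, Measure.restrict_map hm measurableSet_Icc, hpre]

lemma stratum_subset {n : ℕ} (hn : 1 ≤ n) (i : Fin n) :
    Icc (((i : ℕ) : ℝ) / n) (((i : ℕ) + 1) / n) ⊆ Icc 0 1 := by
  have hn0 : (0 : ℝ) < n := by exact_mod_cast hn
  refine Icc_subset_Icc (by positivity) ((div_le_one hn0).2 ?_)
  exact_mod_cast i.2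

section Stratified

variable {T : Type*} [MeasurableSpace T] {P : Measure T} {n : ℕ}
  {Δ : Fin n → T → ℝ}

lemma IsIIDUniform.map_eq (hΔ : IsIIDUniform P Δ) (i : Fin n) :
    P.map (Δ i) = volume.restrict (Icc (0 : ℝ) 1) := by
  have h := hΔ.2 i
  unfold pdf.IsUniform ProbabilityTheory.cond at h
  simpa using h

lemma IsIIDUniform.aemeasurable (hΔ : IsIIDUniform P Δ) (i : Fin n) : AEMeasurable (Δ i) P :=
  (hΔ.2 i).aemeasurable (by simp) (by simp)

lemma IsIIDUniform.map_node (hΔ : IsIIDUniform P Δ) (hn : 1 ≤ n) (i : Fin n) :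
    P.map (fun t => ((i : ℕ) + Δ i t) / n) =
      ENNReal.ofReal n • volume.restrict (Icc (((i : ℕ) : ℝ) / n) (((i : ℕ) + 1) / n)) := by
  rw [← map_stratum hn, ← hΔ.map_eq i, AEMeasurable.map_map_of_aemeasurable (by fun_prop)
    (hΔ.aemeasurable i)]
  rfl

lemma IsIIDUniform.aemeasurable_node (hΔ : IsIIDUniform P Δ) (i : Fin n) :
    AEMeasurable (fun t => ((i : ℕ) + Δ i t) / n) P :=
  ((hΔ.aemeasurable i).const_add _).div_const _

variable {F : ℝ → ℝ}

lemma IsIIDUniform.memLp_node (hΔ : IsIIDUniform P Δ) (hn : 1 ≤ n)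
    (hF : MemLp F 2 (volume.restrict (Icc 0 1))) (i : Fin n) :
    MemLp (fun t => F (((i : ℕ) + Δ i t) / n)) 2 P := by
  refine MemLp.comp_of_map (g := F) ?_ (hΔ.aemeasurable_node i)
  rw [hΔ.map_node hn]
  exact (hF.mono_measure (Measure.restrict_mono (stratum_subset hn i) le_rfl)).smul_measure
    ENNReal.ofReal_ne_top

lemma IsIIDUniform.integral_node (hΔ : IsIIDUniform P Δ) (hn : 1 ≤ n)
    (hF : MemLp F 2 (volume.restrict (Icc 0 1))) (i : Fin n) :
    ∫ t, F (((i : ℕ) + Δ i t) / n) ∂P =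
      n * ∫ x in (((i : ℕ) : ℝ) / n)..(((i : ℕ) + 1 : ℕ) : ℝ) / n, F x := by
  have hFi := (hF.mono_measure (Measure.restrict_mono (stratum_subset hn i) le_rfl)).smul_measure
    (c := ENNReal.ofReal n) ENNReal.ofReal_ne_top
  rw [← hΔ.map_node hn] at hFi
  rw [← integral_map (hΔ.aemeasurable_node i) hFi.aestronglyMeasurable, hΔ.map_node hn,
    integral_smul_measure, ENNReal.toReal_ofReal (by positivity), smul_eq_mul,
    intervalIntegral.integral_of_le (by gcongr; simp), integral_Icc_eq_integral_Ioc]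
  push_cast
  rfl

lemma IsIIDUniform.integral_estimate [IsProbabilityMeasure P] (hΔ : IsIIDUniform P Δ) (hn : 1 ≤ n)
    (hF : MemLp F 2 (volume.restrict (Icc 0 1))) :
    ∫ t, (1 / (n : ℝ)) * ∑ i : Fin n, F (((i : ℕ) + Δ i t) / n) ∂P = ∫ x in Icc 0 1, F x := by
  have hn0 : (n : ℝ) ≠ 0 := by positivity
  rw [integral_const_mul, integral_finsetSum _ fun i _ =>
    (hΔ.memLp_node hn hF i).integrable (by norm_num)]
  simp_rw [hΔ.integral_node hn hF]
  rw [← Finset.mul_sum, ← mul_assoc, one_div_mul_cancel hn0, one_mul,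
    Fin.sum_univ_eq_sum_range (fun k => ∫ x in ((k : ℝ) / n)..((k + 1 : ℕ) : ℝ) / n, F x),
    intervalIntegral.sum_integral_adjacent_intervals (a := fun k => (k : ℝ) / n)]
  · simp only [Nat.cast_zero, zero_div, div_self hn0]
    rw [intervalIntegral.integral_of_le zero_le_one, integral_Icc_eq_integral_Ioc]
  · intro k hk
    have hle : (k : ℝ) / n ≤ ((k + 1 : ℕ) : ℝ) / n := by gcongr; simp
    rw [intervalIntegrable_iff_integrableOn_Icc_of_le hle]
    have hFint : IntegrableOn F (Icc 0 1) := hF.integrable (by norm_num)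
    refine hFint.mono_set ?_
    push_cast
    exact stratum_subset hn ⟨k, hk⟩

lemma IsIIDUniform.memLp_latticeEstimate (hΔ : IsIIDUniform P Δ) (hn : 1 ≤ n) {d : ℕ}
    {H : ℝ → EuclideanSpace ℝ (Fin d)} {f : EuclideanSpace ℝ (Fin d) → ℝ}
    (hF : MemLp (f ∘ H) 2 (volume.restrict (Icc 0 1))) :
    MemLp (fun t => latticeEstimate H f fun i => Δ i t) 2 P :=
  (memLp_finsetSum _ fun i _ => hΔ.memLp_node hn hF i).const_mul _

/-- The variance of the stratified estimator is the sum of the contributions of the strata, and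
that of a stratum is controlled by the oscillation of the integrand. -/
lemma IsIIDUniform.variance_estimate_le [IsProbabilityMeasure P] (hΔ : IsIIDUniform P Δ) (hn : 1 ≤ n)
    (hF : MemLp F 2 (volume.restrict (Icc 0 1))) {c r : Fin n → ℝ}
    (h : ∀ i : Fin n, ∀ x ∈ Icc (((i : ℕ) : ℝ) / n) (((i : ℕ) + 1) / n), |F x - c i| ≤ r i) :
    variance (fun t => (1 / (n : ℝ)) * ∑ i : Fin n, F (((i : ℕ) + Δ i t) / n)) P ≤
      (1 / (n : ℝ)) ^ 2 * ∑ i, r i ^ 2 := by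
  have hn0 : (0 : ℝ) < n := by exact_mod_cast hn
  have hind : iIndepFun (fun (i : Fin n) t => F (((i : ℕ) + Δ i t) / n)) P := by
    refine hΔ.1.comp₀ (fun i u => F (((i : ℕ) + u) / n)) hΔ.aemeasurable fun i => ?_
    have hFi := (hF.mono_measure (Measure.restrict_mono (stratum_subset hn i) le_rfl)).smul_measure
      (c := ENNReal.ofReal n) ENNReal.ofReal_ne_top
    rw [← map_stratum hn] at hFi
    rw [hΔ.map_eq]
    exact hFi.aestronglyMeasurable.aemeasurable.comp_aemeasurable (by fun_prop)
  rw [variance_const_mul]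
  refine mul_le_mul_of_nonneg_left ?_ (by positivity)
  have hsum := IndepFun.variance_sum (s := Finset.univ)
    (X := fun (i : Fin n) t => F (((i : ℕ) + Δ i t) / n)) (fun i _ => hΔ.memLp_node hn hF i)
    fun i _ j _ hij => hind.indepFun hij
  have e : (∑ i : Fin n, fun t => F (((i : ℕ) + Δ i t) / n)) =
      fun t => ∑ i : Fin n, F (((i : ℕ) + Δ i t) / n) := by
    funext t
    simp
  rw [e] at hsum
  rw [hsum]
  refine Finset.sum_le_sum fun i _ => ?_
  have hmem : ∀ᵐ t ∂P, Δ i t ∈ Icc (0 : ℝ) 1 := by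
    refine ae_of_ae_map (hΔ.aemeasurable i) ?_
    rw [hΔ.map_eq]
    exact ae_restrict_mem measurableSet_Icc
  refine (variance_le_sq_of_bounded (a := c i - r i) (b := c i + r i) ?_
    (hΔ.memLp_node hn hF i).aestronglyMeasurable.aemeasurable).trans_eq (by ring)
  filter_upwards [hmem] with t ht
  have := abs_le.1 (h i (((i : ℕ) + Δ i t) / n) ⟨by gcongr; linarith [ht.1], by
    gcongr; exact ht.2⟩)
  constructor <;> linarith [this.1, this.2]

end Stratified

/-! ### Lipschitz integrands -/

section Lipschitz

variable {d : ℕ} {f : EuclideanSpace ℝ (Fin d) → ℝ}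

lemma LipschitzOnCube.exists_nonneg (hf : LipschitzOnCube f) :
    ∃ M : ℝ, 0 ≤ M ∧ ∀ x ∈ unitCube d, ∀ y ∈ unitCube d, |f x - f y| ≤ M * ‖x - y‖ := by
  obtain ⟨M, hM⟩ := hf
  exact ⟨|M|, abs_nonneg _, fun x hx y hy => (hM x hx y hy).trans
    (mul_le_mul_of_nonneg_right (le_abs_self M) (norm_nonneg _))⟩

lemma LipschitzOnCube.continuousOn (hf : LipschitzOnCube f) : ContinuousOn f (unitCube d) := by
  obtain ⟨M, hM0, hM⟩ := hf.exists_nonneg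
  refine (LipschitzOnWith.of_dist_le_mul (K := ⟨M, hM0⟩) fun x hx y hy => ?_).continuousOn
  rw [Real.dist_eq, dist_eq_norm]
  exact hM x hx y hy

lemma LipschitzOnCube.aestronglyMeasurable (hf : LipschitzOnCube f) :
    AEStronglyMeasurable f (volume.restrict (unitCube d)) :=
  hf.continuousOn.aestronglyMeasurable (isClosed_unitCube d).measurableSet

lemma LipschitzOnCube.exists_bound (hf : LipschitzOnCube f) :
    ∃ B : ℝ, 0 ≤ B ∧ ∀ x ∈ unitCube d, |f x| ≤ B := by
  obtain ⟨M, hM0, hM⟩ := hf.exists_nonneg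
  have h0 : (0 : EuclideanSpace ℝ (Fin d)) ∈ unitCube d := fun j => by simp
  refine ⟨|f 0| + M * (√d * 1), by positivity, fun x hx => ?_⟩
  have h1 : ‖x‖ ≤ √d * 1 := norm_le_of_forall_coord_le zero_le_one fun j =>
    abs_le.2 ⟨by linarith [(hx j).1], (hx j).2⟩
  have h2 := hM x hx 0 h0
  rw [sub_zero] at h2
  have h3 := abs_sub_abs_le_abs_sub (f x) (f 0)
  linarith [mul_le_mul_of_nonneg_left h1 hM0]

lemma LipschitzOnCube.memLp (hf : LipschitzOnCube f) :
    MemLp f 2 (volume.restrict (unitCube d)) := by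
  obtain ⟨B, -, hB⟩ := hf.exists_bound
  exact MemLp.of_bound hf.aestronglyMeasurable B
    ((ae_restrict_iff' (isClosed_unitCube d).measurableSet).2 (ae_of_all _ hB))

end Lipschitz

/-- On a stratum of length `1 / n` the curve varies by at most `4 √d n ^ (-1 / d)`. -/
lemma HilbertSequence.norm_curve_sub_le_of_mem_stratum {d : ℕ} (S : HilbertSequence d) (hd : 1 ≤ d)
    {n : ℕ} (hn : 1 ≤ n) {i : ℕ} {x y : ℝ} (hx : x ∈ Icc ((i : ℝ) / n) ((i + 1) / n))
    (hy : y ∈ Icc ((i : ℝ) / n) ((i + 1) / n)) :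
    ‖S.curve x - S.curve y‖ ≤ 4 * √d * (n : ℝ) ^ (-1 / (d : ℝ)) := by
  have hn0 : (0 : ℝ) < n := by exact_mod_cast hn
  have hi : (0 : ℝ) ≤ (i : ℝ) / n := by positivity
  refine S.norm_curve_sub_le hd hn (hi.trans hx.1) (hi.trans hy.1) ?_
  have h : |x - y| ≤ 1 / n := by
    have e : ((i : ℝ) + 1) / n = i / n + 1 / n := by ring
    rw [e] at hx hy
    rw [abs_le]
    constructor <;> linarith [hx.1, hx.2, hy.1, hy.2]
  rwa [le_div_iff₀ hn0, mul_comm] at h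

lemma IsIIDUniform.variance_lipschitz_le {d : ℕ} (hd : 1 ≤ d) (S : HilbertSequence d)
    {f : EuclideanSpace ℝ (Fin d) → ℝ} {M : ℝ} (hf : LipschitzOnCube f) (hM0 : 0 ≤ M)
    (hM : ∀ x ∈ unitCube d, ∀ y ∈ unitCube d, |f x - f y| ≤ M * ‖x - y‖)
    {n : ℕ} (hn : 1 ≤ n) {T : Type*} [MeasurableSpace T] {P : Measure T} [IsProbabilityMeasure P]
    {Δ : Fin n → T → ℝ} (hΔ : IsIIDUniform P Δ) :
    variance (fun t => latticeEstimate S.curve f (fun i => Δ i t)) P ≤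
      (M * (4 * √d)) ^ 2 * (n : ℝ) ^ (-1 - 2 / (d : ℝ)) := by
  have hn0 : (0 : ℝ) < n := by exact_mod_cast hn
  set δ := (n : ℝ) ^ (-1 / (d : ℝ)) with hδ
  have hpow : (n : ℝ) ^ (-1 - 2 / (d : ℝ)) = (n : ℝ)⁻¹ * δ ^ 2 := by
    rw [hδ, ← Real.rpow_natCast, ← Real.rpow_mul hn0.le, ← Real.rpow_neg_one,
      ← Real.rpow_add hn0]
    congr 1
    push_cast
    ring
  refine (hΔ.variance_estimate_le hn (hf.memLp.comp_measurePreserving S.measurePreserving_curve)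
    (c := fun i => f (S.curve (((i : ℕ) : ℝ) / n))) (r := fun _ => M * (4 * √d * δ))
    fun i x hx => ?_).trans_eq ?_
  · refine (hM _ (S.curve_mem_unitCube _) _ (S.curve_mem_unitCube _)).trans
      (mul_le_mul_of_nonneg_left ?_ hM0)
    exact S.norm_curve_sub_le_of_mem_stratum hd hn hx (left_mem_Icc.2 (by gcongr; linarith))
  · rw [hpow, Finset.sum_const, Finset.card_univ, Fintype.card_fin, nsmul_eq_mul]
    field_simp

/-! ### Integrands that jump across a boundary with Minkowski content -/

/-- The Minkowski content controls the measure of the neighbourhoods of the boundary of every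
width; wide ones are dealt with by the trivial bound `1` in the unit cube. -/
lemma AdmitsMinkowskiContent.exists_measure_cthickening_le {d : ℕ}
    {Ω : Set (EuclideanSpace ℝ (Fin d))} (h : AdmitsMinkowskiContent Ω) :
    ∃ K : ℝ, 0 ≤ K ∧ ∀ ε : ℝ, 0 < ε →
      volume.restrict (unitCube d) (Metric.cthickening ε (frontier Ω)) ≤
        ENNReal.ofReal (K * ε) := by
  obtain ⟨M, hM⟩ := h
  have hev := hM.eventually (eventually_le_nhds
    (ENNReal.lt_add_right (a := (M : ℝ≥0∞)) ENNReal.coe_ne_top one_ne_zero))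
  obtain ⟨ε₀, hε₀, hsub⟩ := mem_nhdsGT_iff_exists_Ioo_subset.1 hev
  rw [mem_Ioi] at hε₀
  refine ⟨2 * (M + 1) + 1 / ε₀, by positivity, fun ε hε => ?_⟩
  rcases lt_or_ge ε ε₀ with hlt | hge
  · have h1 := hsub ⟨hε, hlt⟩
    simp only [mem_ofPred_eq] at h1
    rw [ENNReal.div_le_iff (by simpa using hε) ENNReal.ofReal_ne_top] at h1
    refine (Measure.restrict_apply_le _ _).trans (h1.trans ?_)
    have e : (M : ℝ≥0∞) + 1 = ENNReal.ofReal (M + 1) := by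
      rw [ENNReal.ofReal_add (by positivity) zero_le_one]
      simp
    rw [e, ← ENNReal.ofReal_mul (by positivity)]
    refine ENNReal.ofReal_le_ofReal ?_
    have : 0 ≤ 1 / ε₀ * ε := by positivity
    linarith
  · refine prob_le_one.trans ?_
    rw [← ENNReal.ofReal_one]
    refine ENNReal.ofReal_le_ofReal ?_
    have h1 : 1 ≤ 1 / ε₀ * ε := by
      rw [one_div, inv_mul_eq_div]
      exact (one_le_div hε₀).2 hge
    have h2 : 0 ≤ 2 * ((M : ℝ) + 1) * ε := by positivity
    linarith

lemma AdmitsMinkowskiContent.measure_frontier {d : ℕ}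
    {Ω : Set (EuclideanSpace ℝ (Fin d))} (h : AdmitsMinkowskiContent Ω) :
    volume.restrict (unitCube d) (frontier Ω) = 0 := by
  obtain ⟨K, -, hK⟩ := h.exists_measure_cthickening_le
  have hlim : Tendsto (fun ε : ℝ => ENNReal.ofReal (K * ε)) (𝓝[>] 0) (𝓝 0) := by
    have : Tendsto (fun ε : ℝ => ENNReal.ofReal (K * ε)) (𝓝 0) (𝓝 (ENNReal.ofReal (K * 0))) :=
      (ENNReal.continuous_ofReal.comp (continuous_const.mul continuous_id)).tendsto 0
    rw [mul_zero, ENNReal.ofReal_zero] at this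
    exact this.mono_left nhdsWithin_le_nhds
  refine le_antisymm (ge_of_tendsto hlim ?_) zero_le
  filter_upwards [self_mem_nhdsWithin] with ε hε
  exact (measure_mono (Metric.self_subset_cthickening _)).trans (hK ε hε)

lemma LipschitzOnCube.memLp_indicator {d : ℕ} {g : EuclideanSpace ℝ (Fin d) → ℝ}
    {Ω : Set (EuclideanSpace ℝ (Fin d))} (hg : LipschitzOnCube g) (h : AdmitsMinkowskiContent Ω) :
    MemLp (Ω.indicator g) 2 (volume.restrict (unitCube d)) := by
  obtain ⟨B, -, hB⟩ := hg.exists_bound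
  refine MemLp.of_bound (hg.aestronglyMeasurable.indicator₀
    (nullMeasurableSet_of_null_frontier h.measure_frontier)) B
    ((ae_restrict_iff' (isClosed_unitCube d).measurableSet).2 (ae_of_all _ fun x hx => ?_))
  exact (norm_indicator_le_norm_self g x).trans (hB x hx)

/-- A segment from a point of a set to a point outside it meets the boundary. -/
lemma exists_mem_segment_frontier {E : Type*} [NormedAddCommGroup E] [NormedSpace ℝ E] {Ω : Set E}
    {a b : E} (ha : a ∈ Ω) (hb : b ∉ Ω) : ∃ p ∈ segment ℝ a b, p ∈ frontier Ω := by
  by_contra! hne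
  have hcov : segment ℝ a b ⊆ interior Ω ∪ (closure Ω)ᶜ := fun p hp => by
    have := hne p hp
    by_cases hi : p ∈ interior Ω
    · exact Or.inl hi
    · exact Or.inr fun hc => this ⟨hc, hi⟩
  obtain ⟨p, -, hp1, hp2⟩ := (convex_segment a b).isPreconnected _ _ isOpen_interior
    isClosed_closure.isOpen_compl hcov
    ⟨a, left_mem_segment ℝ a b, (hcov (left_mem_segment ℝ a b)).resolve_right
      fun h => h (subset_closure ha)⟩
    ⟨b, right_mem_segment ℝ a b, (hcov (right_mem_segment ℝ a b)).resolve_left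
      fun h => hb (interior_subset h)⟩
  exact hp2 (interior_subset_closure hp1)

/-- The strata whose image under the curve meets both `Ω` and its complement. -/
def HilbertSequence.crossing {d : ℕ} (S : HilbertSequence d) (Ω : Set (EuclideanSpace ℝ (Fin d)))
    (n : ℕ) : Set (Fin n) :=
  {i | ∃ x ∈ Icc (((i : ℕ) : ℝ) / n) (((i : ℕ) + 1) / n),
    ∃ y ∈ Icc (((i : ℕ) : ℝ) / n) (((i : ℕ) + 1) / n), S.curve x ∈ Ω ∧ S.curve y ∉ Ω}

/-- The images of the crossing strata lie near the boundary of `Ω`, and their measures add up, as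
the curve preserves measure; so the measure of that neighbourhood bounds their number. -/
lemma HilbertSequence.ncard_crossing_le {d : ℕ} (hd : 1 ≤ d) (S : HilbertSequence d)
    {Ω : Set (EuclideanSpace ℝ (Fin d))} {K : ℝ} (hK0 : 0 ≤ K)
    (hK : ∀ ε : ℝ, 0 < ε → volume.restrict (unitCube d) (Metric.cthickening ε (frontier Ω)) ≤
      ENNReal.ofReal (K * ε)) {n : ℕ} (hn : 1 ≤ n) :
    ((S.crossing Ω n).ncard : ℝ) ≤ n * (K * (4 * √d * (n : ℝ) ^ (-1 / (d : ℝ)))) := by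
  classical
  have hn0 : (0 : ℝ) < n := by exact_mod_cast hn
  have hd0 : (0 : ℝ) < d := by exact_mod_cast hd
  set D := 4 * √d * (n : ℝ) ^ (-1 / (d : ℝ)) with hD
  have hDpos : 0 < D := by positivity
  set s : Finset ℕ := (S.crossing Ω n).toFinset.map Fin.valEmbedding with hs
  have hcard : s.card = (S.crossing Ω n).ncard := by
    rw [hs, Finset.card_map, ncard_eq_toFinset_card']
  have hsub : Icc 0 1 ∩ floorIndex n ⁻¹' s ⊆
      S.curve ⁻¹' Metric.cthickening D (frontier Ω) := by
    rintro z ⟨hz, hzs⟩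
    obtain ⟨i, hi, hiz⟩ := Finset.mem_map.1 (Finset.mem_coe.1 (mem_preimage.1 hzs))
    obtain ⟨x, hx, y, hy, hxΩ, hyΩ⟩ := mem_toFinset.1 hi
    have hzi : z ∈ Icc (((i : ℕ) : ℝ) / n) (((i : ℕ) + 1) / n) :=
      floorIndex_subset_Icc (by omega) ⟨hz, hiz.symm⟩
    obtain ⟨p, hp, hpf⟩ := exists_mem_segment_frontier hxΩ hyΩ
    -- the ball around `S.curve z` is convex and contains both ends of the segment
    have hpball : p ∈ Metric.closedBall (S.curve z) D := by
      refine (convex_closedBall (S.curve z) D).segment_subset ?_ ?_ hp <;>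
        rw [mem_closedBall_iff_norm]
      · exact S.norm_curve_sub_le_of_mem_stratum hd hn hx hzi
      · exact S.norm_curve_sub_le_of_mem_stratum hd hn hy hzi
    refine Metric.mem_cthickening_of_dist_le _ p _ _ hpf ?_
    rw [dist_comm]
    exact hpball
  have hmeas : ∑ k ∈ s, volume.restrict (Icc (0 : ℝ) 1) (floorIndex n ⁻¹' {k}) ≤
      ENNReal.ofReal (K * D) := by
    rw [sum_measure_preimage_singleton s fun k _ =>
      measurable_floorIndex n (measurableSet_singleton k),
      Measure.restrict_apply (measurable_floorIndex n s.measurableSet), inter_comm]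
    calc volume (Icc 0 1 ∩ floorIndex n ⁻¹' s)
        = volume.restrict (Icc (0 : ℝ) 1) (Icc 0 1 ∩ floorIndex n ⁻¹' s) :=
          (Measure.restrict_eq_self _ inter_subset_left).symm
      _ ≤ volume.restrict (Icc (0 : ℝ) 1) (S.curve ⁻¹' Metric.cthickening D (frontier Ω)) :=
          measure_mono hsub
      _ = volume.restrict (unitCube d) (Metric.cthickening D (frontier Ω)) :=
          S.measurePreserving_curve.measure_preimage
            Metric.isClosed_cthickening.measurableSet.nullMeasurableSet
      _ ≤ _ := hK D hDpos
  have hterm : ∀ k ∈ s, volume.restrict (Icc (0 : ℝ) 1) (floorIndex n ⁻¹' {k}) =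
      ENNReal.ofReal (1 / n) := by
    intro k hk
    obtain ⟨i, -, rfl⟩ := Finset.mem_map.1 hk
    rw [Measure.restrict_apply (measurable_floorIndex n (measurableSet_singleton _)), inter_comm]
    exact volume_floorIndex i.2
  rw [Finset.sum_congr rfl hterm, Finset.sum_const, hcard, nsmul_eq_mul, ← ENNReal.ofReal_natCast,
    ← ENNReal.ofReal_mul (by positivity), ENNReal.ofReal_le_ofReal_iff (by positivity),
    mul_one_div, div_le_iff₀ hn0] at hmeas
  linarith

lemma IsIIDUniform.variance_indicator_le {d : ℕ} (hd : 1 ≤ d) (S : HilbertSequence d)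
    {g : EuclideanSpace ℝ (Fin d) → ℝ} {Ω : Set (EuclideanSpace ℝ (Fin d))} {M B K : ℝ}
    (hg : LipschitzOnCube g) (hΩ : AdmitsMinkowskiContent Ω) (hM0 : 0 ≤ M)
    (hM : ∀ x ∈ unitCube d, ∀ y ∈ unitCube d, |g x - g y| ≤ M * ‖x - y‖)
    (hB : ∀ x ∈ unitCube d, |g x| ≤ B) (hK0 : 0 ≤ K)
    (hK : ∀ ε : ℝ, 0 < ε → volume.restrict (unitCube d) (Metric.cthickening ε (frontier Ω)) ≤
      ENNReal.ofReal (K * ε))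
    {n : ℕ} (hn : 1 ≤ n) {T : Type*} [MeasurableSpace T] {P : Measure T} [IsProbabilityMeasure P]
    {Δ : Fin n → T → ℝ} (hΔ : IsIIDUniform P Δ) :
    variance (fun t => latticeEstimate S.curve (Ω.indicator g) (fun i => Δ i t)) P ≤
      (K * (4 * √d) * (2 * B) ^ 2 + (M * (4 * √d)) ^ 2) * (n : ℝ) ^ (-1 - 1 / (d : ℝ)) := by
  classical
  have hn0 : (0 : ℝ) < n := by exact_mod_cast hn
  set δ := (n : ℝ) ^ (-1 / (d : ℝ)) with hδ
  have hδ0 : 0 < δ := by positivity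
  have hδ1 : δ ≤ 1 := Real.rpow_le_one_of_one_le_of_nonpos (by exact_mod_cast hn)
    (div_nonpos_of_nonpos_of_nonneg (by norm_num) (by positivity))
  have hpow : (n : ℝ) ^ (-1 - 1 / (d : ℝ)) = (n : ℝ)⁻¹ * δ := by
    rw [hδ, ← Real.rpow_neg_one, ← Real.rpow_add hn0]
    congr 1
    ring
  have hbound (x : ℝ) : |Ω.indicator g (S.curve x)| ≤ B :=
    (norm_indicator_le_norm_self g _).trans (hB _ (S.curve_mem_unitCube x))
  have hcard := S.ncard_crossing_le hd hK0 hK hn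
  refine (hΔ.variance_estimate_le hn
    ((hg.memLp_indicator hΩ).comp_measurePreserving S.measurePreserving_curve)
    (c := fun i => Ω.indicator g (S.curve (((i : ℕ) : ℝ) / n)))
    (r := fun i => if i ∈ S.crossing Ω n then 2 * B else M * (4 * √d * δ))
    fun i x hx => ?_).trans ?_
  · have hl : ((i : ℕ) : ℝ) / n ∈ Icc (((i : ℕ) : ℝ) / n) (((i : ℕ) + 1) / n) :=
      left_mem_Icc.2 (by gcongr; linarith)
    simp only [Function.comp_apply]
    split_ifs with hi
    · have h1 := abs_le.1 (hbound x)
      have h2 := abs_le.1 (hbound (((i : ℕ) : ℝ) / n))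
      rw [abs_le]
      constructor <;> linarith [h1.1, h1.2, h2.1, h2.2]
    · by_cases hxΩ : S.curve x ∈ Ω
      · have hlΩ : S.curve (((i : ℕ) : ℝ) / n) ∈ Ω := by
          by_contra hlΩ
          exact hi ⟨x, hx, _, hl, hxΩ, hlΩ⟩
        rw [indicator_of_mem hxΩ, indicator_of_mem hlΩ]
        exact (hM _ (S.curve_mem_unitCube _) _ (S.curve_mem_unitCube _)).trans
          (mul_le_mul_of_nonneg_left (S.norm_curve_sub_le_of_mem_stratum hd hn hx hl) hM0)
      · have hlΩ : S.curve (((i : ℕ) : ℝ) / n) ∉ Ω := fun hlΩ => hi ⟨_, hl, x, hx, hlΩ, hxΩ⟩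
        rw [indicator_of_notMem hxΩ, indicator_of_notMem hlΩ, sub_zero, abs_zero]
        positivity
  · have hsum : ∑ i : Fin n, (if i ∈ S.crossing Ω n then 2 * B else M * (4 * √d * δ)) ^ 2 ≤
        (S.crossing Ω n).ncard * (2 * B) ^ 2 + n * (M * (4 * √d * δ)) ^ 2 := by
      calc ∑ i : Fin n, (if i ∈ S.crossing Ω n then 2 * B else M * (4 * √d * δ)) ^ 2
          ≤ ∑ i : Fin n, ((if i ∈ S.crossing Ω n then (2 * B) ^ 2 else 0) +
              (M * (4 * √d * δ)) ^ 2) := by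
            refine Finset.sum_le_sum fun i _ => ?_
            split_ifs
            · exact le_add_of_nonneg_right (sq_nonneg _)
            · rw [zero_add]
        _ = (S.crossing Ω n).ncard * (2 * B) ^ 2 + n * (M * (4 * √d * δ)) ^ 2 := by
            rw [Finset.sum_add_distrib, ← Finset.sum_filter, Finset.sum_const, Finset.sum_const,
              Finset.card_univ, Fintype.card_fin, nsmul_eq_mul, nsmul_eq_mul,
              ncard_eq_toFinset_card', toFinset]
            congr 4
            ext i
            simp
    calc (1 / (n : ℝ)) ^ 2 *
          ∑ i : Fin n, (if i ∈ S.crossing Ω n then 2 * B else M * (4 * √d * δ)) ^ 2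
        ≤ (1 / (n : ℝ)) ^ 2 *
          (n * (K * (4 * √d * δ)) * (2 * B) ^ 2 + n * ((M * (4 * √d)) ^ 2 * δ)) := by
          refine mul_le_mul_of_nonneg_left (hsum.trans (add_le_add ?_ ?_)) (by positivity)
          · exact mul_le_mul_of_nonneg_right hcard (sq_nonneg _)
          · refine mul_le_mul_of_nonneg_left ?_ hn0.le
            calc (M * (4 * √d * δ)) ^ 2 = (M * (4 * √d)) ^ 2 * δ * δ := by ring
              _ ≤ (M * (4 * √d)) ^ 2 * δ := mul_le_of_le_one_right (by positivity) hδ1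
      _ = _ := by
          rw [hpow]
          field_simp

theorem mainTheorem3 (d : ℕ) (hd : 1 ≤ d) (S : HilbertSequence d) :
    (∀ f : EuclideanSpace ℝ (Fin d) → ℝ, MemLp f 2 (volume.restrict (unitCube d)) →
      ∀ n : ℕ, 1 ≤ n → ∀ (T : Type u) [MeasurableSpace T] (P : Measure T)
        [IsProbabilityMeasure P] (Δ : Fin n → T → ℝ), IsIIDUniform P Δ →
        MemLp (fun t => latticeEstimate S.curve f (fun i => Δ i t)) 2 P ∧
        ∫ t, latticeEstimate S.curve f (fun i => Δ i t) ∂P = ∫ x in unitCube d, f x) ∧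
    (∀ f : EuclideanSpace ℝ (Fin d) → ℝ, LipschitzOnCube f →
      ∃ C : ℝ, ∀ n : ℕ, 1 ≤ n → ∀ (T : Type u) [MeasurableSpace T] (P : Measure T)
        [IsProbabilityMeasure P] (Δ : Fin n → T → ℝ), IsIIDUniform P Δ →
        MemLp (fun t => latticeEstimate S.curve f (fun i => Δ i t)) 2 P ∧
        variance (fun t => latticeEstimate S.curve f (fun i => Δ i t)) P ≤
          C * (n : ℝ) ^ (-1 - 2 / (d : ℝ))) ∧
    (∀ (g : EuclideanSpace ℝ (Fin d) → ℝ) (Ω : Set (EuclideanSpace ℝ (Fin d))),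
      LipschitzOnCube g → Ω ⊆ unitCube d → AdmitsMinkowskiContent Ω →
      ∃ C : ℝ, ∀ n : ℕ, 1 ≤ n → ∀ (T : Type u) [MeasurableSpace T] (P : Measure T)
        [IsProbabilityMeasure P] (Δ : Fin n → T → ℝ), IsIIDUniform P Δ →
        MemLp (fun t => latticeEstimate S.curve (Ω.indicator g) (fun i => Δ i t)) 2 P ∧
        variance (fun t => latticeEstimate S.curve (Ω.indicator g) (fun i => Δ i t)) P ≤
          C * (n : ℝ) ^ (-1 - 1 / (d : ℝ))) := by
  refine ⟨fun f hf n hn T _ P _ Δ hΔ => ?_, fun f hf => ?_, fun g Ω hg _ hΩ => ?_⟩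
  · have hF := hf.comp_measurePreserving S.measurePreserving_curve
    refine ⟨hΔ.memLp_latticeEstimate hn hF, (hΔ.integral_estimate hn hF).trans ?_⟩
    have hmap := S.measurePreserving_curve.map_eq
    rw [← hmap, integral_map S.measurable_curve.aemeasurable
      (hmap.symm ▸ hf.aestronglyMeasurable)]
    rfl
  · obtain ⟨M, hM0, hM⟩ := hf.exists_nonneg
    have hF := hf.memLp.comp_measurePreserving S.measurePreserving_curve
    exact ⟨(M * (4 * √d)) ^ 2, fun n hn T _ P _ Δ hΔ => ⟨hΔ.memLp_latticeEstimate hn hF,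
        hΔ.variance_lipschitz_le hd S hf hM0 hM hn⟩⟩
  · obtain ⟨M, hM0, hM⟩ := hg.exists_nonneg
    obtain ⟨B, -, hB⟩ := hg.exists_bound
    obtain ⟨K, hK0, hK⟩ := hΩ.exists_measure_cthickening_le
    have hF := (hg.memLp_indicator hΩ).comp_measurePreserving S.measurePreserving_curve
    exact ⟨K * (4 * √d) * (2 * B) ^ 2 + (M * (4 * √d)) ^ 2, fun n hn T _ P _ Δ hΔ =>
      ⟨hΔ.memLp_latticeEstimate hn hF,
        hΔ.variance_indicator_le hd S hg hΩ hM0 hM hB hK0 hK hn⟩⟩
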